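/- Let $t,n_1,\dots,n_t,m_1,\dots,m_t$ be positive integers with $m_1\ge\dots\ge m_t$ and $m_i\ge n_i$ for all $i$, let $\mathbb F_q$ be the finite field with $q$ elements, and let $\mathbb M=\mathbb F_q^{m_1\times n_1}\times\dots\times\mathbb F_q^{m_t\times n_t}$, $n=n_1+\dots+n_t$. The sum-rank weight of $C=(C_1,\dots,C_t)\in\mathbb M$ is $\mathrm{srk}(C)=\sum_{i=1}^t\mathrm{rk}(C_i)$. The minimum distance of a nonzero $\mathbb F_q$-linear subspace (code) $\mathcal C\subseteq\mathbb M$ is $d(\mathcal C)=\min\{\mathrm{srk}(C): C\in\mathcal C\setminus\{0\}\}$. A nonzero code $\mathcal C\subseteq\mathbb M$ is called maximum sum-rank distance (MSRD) if there exist $k\in\{1,\dots,t\}$ and $0\le\delta\le n_k-1$ such that $$d(\mathcal C)=\sum_{i=1}^{k-1}n_i+\delta+1\quad\text{and}\quad \dim(\mathcal C)=\sum_{i=k}^{t}m_in_i-\delta m_k .$$ **Proposition.** Let $j=\min\{i\in\{1,\dots,t\} : m_i=m_t\}$ and $d=\sum_{i=1}^{j-1}n_i+1$. Suppose that $n_i\le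 m_t$ for all $i\in\{1,\dots,t\}$. If $q>t$, then there exist MSRD codes $\mathcal C_n\subseteq\dots\subseteq\mathcal C_{d+1}\subseteq\mathcal C_d\subseteq\mathbb M$ with $d(\mathcal C_i)=i$ for $d\le i\le n$. -/

import Mathlib

namespace SumRank

/-- The ambient space: the product over `i` of the spaces of `m i × n i` matrices over `F`. -/
abbrev Ambient (F : Type*) {t : ℕ} (m n : Fin t → ℕ) : Type _ :=
  ∀ i : Fin t, Matrix (Fin (m i)) (Fin (n i)) F

/-- The sum-rank weight of a tuple of matrices. -/
noncomputable def srk {F : Type*} [Field F] {t : ℕ} {m n : Fin t → ℕ}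
    (X : Ambient F m n) : ℕ :=
  ∑ i, (X i).rank

/-- The minimum distance of a (linear) code: the least sum-rank weight of a nonzero codeword.
For the zero code, which has no minimum distance, this is the junk value `0`; every nonzero
code has a positive minimum distance. -/
noncomputable def minDist {F : Type*} [Field F] {t : ℕ} {m n : Fin t → ℕ}
    (C : Submodule F (Ambient F m n)) : ℕ :=
  sInf {w : ℕ | ∃ X ∈ C, X ≠ 0 ∧ srk X = w}

/-- Maximum sum-rank distance codes: for some index `j` and some `0 ≤ δ ≤ n j - 1`, the minimum
distance is `∑_{i < j} n i + δ + 1` and the dimension is `∑_{i ≥ j} m i * n i - δ * m j`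
(the dimension formula is written without subtraction). -/
def IsMSRD {F : Type*} [Field F] {t : ℕ} {m n : Fin t → ℕ}
    (C : Submodule F (Ambient F m n)) : Prop :=
  ∃ (j : Fin t) (δ : ℕ), δ < n j ∧
    minDist C = (∑ i ∈ Finset.Iio j, n i) + δ + 1 ∧
    Module.finrank F C + δ * m j = ∑ i ∈ Finset.Ici j, (m i * n i)

end SumRank

/-! The codes are linearized Reed-Solomon codes. Let `L` be the extension of `F` of degree `M =
m_t`, and let `σ` have fixed field `F`. A skew polynomial over `L` of degree at most `K` is
evaluated at operators `x ↦ a i * σ x`; each value is restricted to an `n i`-dimensional subspace of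
`L` (possible as `n i ≤ M`) and embedded in `F ^ m i` (as `M ≤ m i`).

If the `a i` are nonzero and pairwise non-conjugate, the kernels of a nonzero skew polynomial have
total dimension at most its degree (`sum_finrank_ker_skewSum_le`), so weights are at least `∑ n i -
K`; a dimension count shows that this is attained. Distinct norms in `Fˣ` ensure non-conjugacy, and
`q > t` supplies enough of them. The code has dimension `M * (K + 1)`, which is the MSRD value
because a distance of at least `d` falls in a block where `m i = M`. Lowering `K` gives the chain.
-/

namespace SumRank

open Polynomial Module

/-! ### Skew polynomials and their kernels -/

section SkewEval

variable {F L : Type*} [Field F] [Field L] [Algebra F L]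

/-- The `σ`-semilinear operator `x ↦ a * σ x`. -/
noncomputable def skewOp (σ : L ≃ₐ[F] L) (a : L) : Module.End F L :=
  Algebra.lmul F L a * σ.toLinearMap

@[simp]
theorem skewOp_apply (σ : L ≃ₐ[F] L) (a x : L) : skewOp σ a x = a * σ x := rfl

theorem skewOp_mul (σ : L ≃ₐ[F] L) (a b x : L) :
    skewOp σ a (b * x) = σ b * skewOp σ a x := by
  simp [mul_left_comm]

theorem skewOp_pow_mul (σ : L ≃ₐ[F] L) (a : L) (k : ℕ) (b x : L) :
    (skewOp σ a ^ k) (b * x) = (σ ^ k) b * (skewOp σ a ^ k) x := by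
  induction k with
  | zero => simp
  | succ k ih =>
    rw [pow_succ', pow_succ', Module.End.mul_apply, ih, skewOp_mul, Module.End.mul_apply,
      AlgEquiv.mul_apply]

/-- The operator `∑ k < N, f k * (a σ) ^ k` attached to a sequence of coefficients. -/
noncomputable def skewSum (σ : L ≃ₐ[F] L) (a : L) (f : ℕ → L) (N : ℕ) : Module.End F L :=
  ∑ k ∈ Finset.range N, Algebra.lmul F L (f k) * skewOp σ a ^ k

theorem skewSum_succ_apply (σ : L ≃ₐ[F] L) (a : L) (f : ℕ → L) (N : ℕ) (x : L) :
    skewSum σ a f (N + 1) x = skewSum σ a f N x + f N * (skewOp σ a ^ N) x := by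
  simp [skewSum, Finset.sum_range_succ]

@[simp]
theorem skewSum_zero_apply (σ : L ≃ₐ[F] L) (a : L) (f : ℕ → L) (x : L) :
    skewSum σ a f 0 x = 0 := by
  simp [skewSum]

theorem skewSum_congr (σ : L ≃ₐ[F] L) (a : L) {f g : ℕ → L} {N : ℕ} (h : ∀ k < N, f k = g k) :
    skewSum σ a f N = skewSum σ a g N :=
  Finset.sum_congr rfl fun k hk => by rw [h k (Finset.mem_range.mp hk)]

/-- Right division with remainder of a skew polynomial of degree `K + 1` by `T - b`. -/
theorem exists_skewSum_div (σ : L ≃ₐ[F] L) (b : L) (K : ℕ) (f : ℕ → L) :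
    ∃ (g : ℕ → L) (r : L), g K = f (K + 1) ∧ ∀ a x,
      skewSum σ a f (K + 2) x = skewSum σ a g (K + 1) (skewOp σ a x - b * x) + r * x := by
  induction K generalizing f with
  | zero =>
    refine ⟨fun _ => f 1, f 0 + f 1 * b, rfl, fun a x => ?_⟩
    simp [skewSum_succ_apply]
    ring
  | succ K ih =>
    -- Since `T ^ (K + 1) * b = (σ ^ (K + 1)) b * T ^ (K + 1)`, splitting off `f (K + 2) * T ^ (K +
    -- 1) * (T - b)` changes only the coefficient of index `K + 1`.
    obtain ⟨g, r, hg, h⟩ := ih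
      (Function.update f (K + 1) (f (K + 1) + f (K + 2) * (σ ^ (K + 1)) b))
    refine ⟨Function.update g (K + 1) (f (K + 2)), r, by simp, fun a x => ?_⟩
    have h' := h a x
    rw [skewSum_succ_apply, skewSum_congr (g := f)] at h'
    swap
    · intro k hk
      rw [Function.update_of_ne (by omega)]
    rw [skewSum_succ_apply, skewSum_succ_apply, skewSum_succ_apply (N := K + 1),
      skewSum_congr (f := Function.update g _ _) (g := g), map_sub (skewOp σ a ^ (K + 1)), skewOp_pow_mul,
      ← Module.End.mul_apply _ (skewOp σ a), ← pow_succ]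
    swap
    · intro k hk
      rw [Function.update_of_ne (by omega)]
    simp only [Function.update_self] at h' ⊢
    linear_combination h'

/-- `B` maps `ker (A * B)` into `ker A`, and what it kills lies in `ker B`. -/
theorem finrank_ker_mul_le {V : Type*} [AddCommGroup V] [Module F V] [Module.Finite F V]
    (A B : Module.End F V) :
    finrank F (LinearMap.ker (A * B)) ≤
      finrank F (LinearMap.ker A) + finrank F (LinearMap.ker B) := by
  have h := (B.domRestrict (LinearMap.ker (A * B))).finrank_range_add_finrank_ker
  have h1 : finrank F (LinearMap.range (B.domRestrict (LinearMap.ker (A * B)))) ≤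
      finrank F (LinearMap.ker A) := by
    apply Submodule.finrank_mono
    rintro _ ⟨⟨x, hx⟩, rfl⟩
    simpa using hx
  have h2 : finrank F (LinearMap.ker (B.domRestrict (LinearMap.ker (A * B)))) ≤
      finrank F (LinearMap.ker B) := by
    refine LinearMap.finrank_le_finrank_of_injective
      (f := ((LinearMap.ker (A * B)).subtype.restrict
        (p := LinearMap.ker (B.domRestrict (LinearMap.ker (A * B)))) (q := LinearMap.ker B) ?_)) ?_
    · rintro ⟨x, hx⟩ h
      simpa using h
    · rintro ⟨⟨x, hx⟩, hx'⟩ ⟨⟨y, hy⟩, hy'⟩ h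
      simpa [Subtype.ext_iff] using h
  omega

/-- A nonzero skew polynomial of degree `K`, evaluated at pairwise non-conjugate points, has at
most `K` independent roots in total. -/
theorem sum_finrank_ker_skewSum_le [Module.Finite F L] {ι : Type*} [Fintype ι]
    (σ : L ≃ₐ[F] L) (hσ : ∀ x, σ x = x → x ∈ Set.range (algebraMap F L)) (a : ι → L)
    (ha0 : ∀ i, a i ≠ 0)
    (ha : ∀ i j x y, x ≠ 0 → y ≠ 0 → a i * σ x * y = a j * σ y * x → i = j)
    (K : ℕ) (f : ℕ → L) (hf : f K ≠ 0) :
    ∑ i, finrank F (LinearMap.ker (skewSum σ (a i) f (K + 1))) ≤ K := by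
  classical
  induction K generalizing f with
  | zero =>
    refine le_of_eq (Finset.sum_eq_zero fun i _ => ?_)
    rw [Submodule.finrank_eq_zero, LinearMap.ker_eq_bot']
    intro x hx
    simpa [skewSum_succ_apply, hf] using hx
  | succ K ih =>
    by_cases hker : ∀ i, LinearMap.ker (skewSum σ (a i) f (K + 2)) = ⊥
    · refine (Finset.sum_eq_zero fun i _ => ?_).trans_le (Nat.zero_le _)
      exact Submodule.finrank_eq_zero.mpr (hker i)
    push Not at hker
    obtain ⟨l, hl⟩ := hker
    obtain ⟨y, hy, hy0⟩ := Submodule.exists_mem_ne_zero_of_ne_bot hl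
    set b := a l * σ y / y with hb
    have hby : skewOp σ (a l) y - b * y = 0 := by
      rw [hb, div_mul_cancel₀ _ hy0, skewOp_apply, sub_self]
    obtain ⟨g, r, hg, h⟩ := exists_skewSum_div σ b K f
    have hr : r = 0 := by
      have := h (a l) y
      rw [hby, map_zero, zero_add, LinearMap.mem_ker.mp hy] at this
      simpa [hy0] using this.symm
    have hmul : ∀ i, skewSum σ (a i) f (K + 2) =
        skewSum σ (a i) g (K + 1) * (skewOp σ (a i) - Algebra.lmul F L b) := by
      intro i
      ext x
      simpa [hr] using h (a i) x
    -- A root `x` at `a i` makes `a i` and `a l` conjugate, so `i = l`; then `σ` fixes `x / y`,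
    -- leaving the line `F y`.
    have hle : ∀ i, finrank F (LinearMap.ker (skewOp σ (a i) - Algebra.lmul F L b)) ≤
        if i = l then 1 else 0 := by
      intro i
      have key : ∀ x, x ∈ LinearMap.ker (skewOp σ (a i) - Algebra.lmul F L b) →
          a i * σ x * y = a l * σ y * x := by
        intro x hx
        have : a i * σ x = b * x := by simpa [sub_eq_zero] using hx
        rw [this, hb]
        field_simp
      split_ifs with hi
      · subst hi
        refine (Submodule.finrank_mono (t := Submodule.span F {y}) ?_).trans
          (finrank_span_singleton hy0).le
        intro x hx
        have hfix : σ (x / y) = x / y := by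
          have hσy : σ y ≠ 0 := by simpa using hy0
          rw [map_div₀, div_eq_div_iff hσy hy0]
          have := key x hx
          rw [mul_assoc, mul_assoc] at this
          rw [mul_left_cancel₀ (ha0 i) this, mul_comm]
        obtain ⟨c, hc⟩ := hσ _ hfix
        refine Submodule.mem_span_singleton.mpr ⟨c, ?_⟩
        rw [Algebra.smul_def, hc, div_mul_cancel₀ _ hy0]
      · rw [Nat.le_zero, Submodule.finrank_eq_zero, Submodule.eq_bot_iff]
        intro x hx
        by_contra hx0
        exact hi (ha i l x y hx0 hy0 (key x hx))
    calc ∑ i, finrank F (LinearMap.ker (skewSum σ (a i) f (K + 2)))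
        ≤ ∑ i, (finrank F (LinearMap.ker (skewSum σ (a i) g (K + 1))) + if i = l then 1 else 0) :=
          Finset.sum_le_sum fun i _ => by
            rw [hmul i]
            exact (finrank_ker_mul_le _ _).trans (Nat.add_le_add_left (hle i) _)
      _ ≤ K + 1 := by
          rw [Finset.sum_add_distrib]
          simpa using ih g (hg ▸ hf)

end SkewEval

end SumRank

namespace SumRank

open Polynomial Module

/-! ### Linearized Reed-Solomon codes -/

section Code

variable {F L : Type*} [Field F] [Field L] [Algebra F L]

/-- Evaluation of a skew polynomial, represented by its coefficients, at the operator
`x ↦ a * σ x`. -/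
noncomputable def skewEval (σ : L ≃ₐ[F] L) (a : L) : L[X] →ₗ[F] Module.End F L :=
  Polynomial.lsum fun k =>
    LinearMap.mulRight F (skewOp σ a ^ k) ∘ₗ (Algebra.lmul F L).toLinearMap

theorem skewEval_eq_skewSum (σ : L ≃ₐ[F] L) (a : L) (f : L[X]) :
    skewEval σ a f = skewSum σ a f.coeff (f.natDegree + 1) := by
  rw [skewSum, skewEval, Polynomial.lsum_apply, Polynomial.sum_over_range _ (by simp)]
  rfl

variable {t : ℕ} {m n : Fin t → ℕ}

/-- The encoder of a linearized Reed-Solomon code: the `i`-th block is the matrix of the skew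
evaluation at `a i`, restricted along `β i` and expanded along `e i`. -/
noncomputable def encode (σ : L ≃ₐ[F] L) (a : Fin t → L) (β : ∀ i, (Fin (n i) → F) →ₗ[F] L)
    (e : ∀ i, L →ₗ[F] (Fin (m i) → F)) : L[X] →ₗ[F] Ambient F m n :=
  LinearMap.pi fun i => LinearMap.toMatrix'.toLinearMap ∘ₗ (LinearMap.compRight F (e i)) ∘ₗ
    (LinearMap.lcomp F L (β i)) ∘ₗ skewEval σ (a i)

theorem encode_apply (σ : L ≃ₐ[F] L) (a : Fin t → L) (β : ∀ i, (Fin (n i) → F) →ₗ[F] L)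
    (e : ∀ i, L →ₗ[F] (Fin (m i) → F)) (f : L[X]) (i : Fin t) :
    encode σ a β e f i = LinearMap.toMatrix' (e i ∘ₗ skewEval σ (a i) f ∘ₗ β i) := rfl

/-- Rank-nullity on `n i` columns: as `β i` and `e i` are injective, the kernel of the block embeds
in that of the operator. -/
theorem le_rank_encode_add [Module.Finite F L] (σ : L ≃ₐ[F] L) (a : Fin t → L)
    (β : ∀ i, (Fin (n i) → F) →ₗ[F] L) (e : ∀ i, L →ₗ[F] (Fin (m i) → F))
    (hβ : ∀ i, Function.Injective (β i)) (he : ∀ i, Function.Injective (e i))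
    (f : L[X]) (i : Fin t) :
    n i ≤ (encode σ a β e f i).rank + finrank F (LinearMap.ker (skewEval σ (a i) f)) := by
  rw [encode_apply, Matrix.rank, ← Matrix.toLin'_apply', Matrix.toLin'_toMatrix']
  set T := e i ∘ₗ skewEval σ (a i) f ∘ₗ β i with hT
  have h := T.finrank_range_add_finrank_ker
  rw [finrank_fin_fun] at h
  have hk : finrank F (LinearMap.ker T) ≤ finrank F (LinearMap.ker (skewEval σ (a i) f)) := by
    refine LinearMap.finrank_le_finrank_of_injective
      (f := (β i).restrict (p := LinearMap.ker T)
        (q := LinearMap.ker (skewEval σ (a i) f)) fun x hx => ?_) fun x y hxy => ?_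
    · refine LinearMap.mem_ker.mpr (he i ?_)
      rw [map_zero]
      exact LinearMap.mem_ker.mp hx
    · exact Subtype.ext (hβ i (congrArg Subtype.val hxy))
  omega

theorem rank_le_card_of_col_eq_zero {p k : ℕ} (A : Matrix (Fin p) (Fin k) F)
    (s : Finset (Fin k)) (h : ∀ c ∉ s, ∀ r, A r c = 0) : A.rank ≤ s.card := by
  classical
  have hA : A = A * Matrix.diagonal (fun c => if c ∈ s then (1 : F) else 0) := by
    ext r c
    rw [Matrix.mul_diagonal]
    split_ifs with hc
    · simp
    · simp [h c hc r]
  rw [hA]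
  refine (Matrix.rank_mul_le_right _ _).trans ?_
  rw [Matrix.rank_diagonal, Fintype.card_subtype]
  exact Finset.card_le_card fun c hc => by simpa using hc

/-- The sum-rank weight of an encoded polynomial. -/
theorem le_srk_encode_add_natDegree [Module.Finite F L] (σ : L ≃ₐ[F] L)
    (hσ : ∀ x, σ x = x → x ∈ Set.range (algebraMap F L)) (a : Fin t → L)
    (ha0 : ∀ i, a i ≠ 0)
    (ha : ∀ i j x y, x ≠ 0 → y ≠ 0 → a i * σ x * y = a j * σ y * x → i = j)
    (β : ∀ i, (Fin (n i) → F) →ₗ[F] L) (e : ∀ i, L →ₗ[F] (Fin (m i) → F))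
    (hβ : ∀ i, Function.Injective (β i)) (he : ∀ i, Function.Injective (e i))
    (f : L[X]) (hf : f ≠ 0) :
    ∑ i, n i ≤ srk (encode σ a β e f) + f.natDegree := by
  have h1 : ∑ i, finrank F (LinearMap.ker (skewEval σ (a i) f)) ≤ f.natDegree :=
    (Finset.sum_congr rfl fun i _ => by rw [skewEval_eq_skewSum]).trans_le
      (sum_finrank_ker_skewSum_le σ hσ a ha0 ha f.natDegree f.coeff (by simpa using hf))
  have h2 := Finset.sum_le_sum fun i (_ : i ∈ Finset.univ) =>
    le_rank_encode_add σ a β e hβ he f i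
  rw [Finset.sum_add_distrib] at h2
  rw [srk]
  omega

theorem finrank_degreeLT_restrictScalars [Module.Finite F L] (K : ℕ) :
    finrank F ((degreeLT L K).restrictScalars F) = finrank F L * K := by
  have := ((degreeLTEquiv L K).restrictScalars F).finrank_eq
  rw [finrank_pi_fintype] at this
  refine this.trans ?_
  simp [mul_comm]

instance [Module.Finite F L] (K : ℕ) : Module.Finite F ((degreeLT L K).restrictScalars F) :=
  Module.Finite.equiv ((degreeLTEquiv L K).restrictScalars F).symm

/-- Making `K` chosen columns vanish imposes `K` conditions with values in `L` on `K + 1`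
coefficients in `L`, so a nonzero solution exists. -/
theorem exists_srk_encode_add_le [Module.Finite F L] (σ : L ≃ₐ[F] L) (a : Fin t → L)
    (β : ∀ i, (Fin (n i) → F) →ₗ[F] L) (e : ∀ i, L →ₗ[F] (Fin (m i) → F))
    (K : ℕ) (hK : K < ∑ i, n i) :
    ∃ f ∈ degreeLT L (K + 1), f ≠ 0 ∧ srk (encode σ a β e f) + K ≤ ∑ i, n i := by
  classical
  obtain ⟨S, -, hS⟩ := Finset.exists_subset_card_eq (s := (Finset.univ : Finset (Σ i, Fin (n i))))
    (n := K) (by simpa using hK.le)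
  let T : ((degreeLT L (K + 1)).restrictScalars F) →ₗ[F] (S → L) :=
    LinearMap.pi fun s => (LinearMap.applyₗ (β s.1.1 (Pi.single s.1.2 1))) ∘ₗ
      skewEval σ (a s.1.1) ∘ₗ Submodule.subtype _
  have hker : LinearMap.ker T ≠ ⊥ := by
    apply LinearMap.ker_ne_bot_of_finrank_lt
    rw [finrank_degreeLT_restrictScalars, finrank_pi_fintype]
    simp only [Finset.sum_const, Finset.card_univ, Fintype.card_coe, hS, smul_eq_mul]
    have : 0 < finrank F L := finrank_pos
    nlinarith
  obtain ⟨⟨f, hf⟩, hfT, hf0⟩ := Submodule.exists_mem_ne_zero_of_ne_bot hker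
  refine ⟨f, hf, fun h => hf0 (Subtype.ext h), ?_⟩
  have hrank : ∀ i, (encode σ a β e f i).rank ≤
      (Finset.univ.filter fun c => (⟨i, c⟩ : Σ i, Fin (n i)) ∉ S).card := by
    intro i
    refine rank_le_card_of_col_eq_zero _ _ fun c hc r => ?_
    have hcS : (⟨i, c⟩ : Σ i, Fin (n i)) ∈ S := by simpa using hc
    have h0 : skewEval σ (a i) f (β i (Pi.single c 1)) = 0 :=
      congrFun (LinearMap.mem_ker.mp hfT) ⟨_, hcS⟩
    rw [encode_apply, LinearMap.toMatrix'_apply]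
    simp [h0]
  have hsum : ∑ i, (Finset.univ.filter fun c => (⟨i, c⟩ : Σ i, Fin (n i)) ∉ S).card =
      (Finset.univ \ S).card := by
    rw [← Finset.card_sigma]
    congr 1
    ext x
    simp
  have hc := Finset.card_sdiff_add_card_eq_card (Finset.subset_univ S)
  have := Finset.sum_le_sum fun i (_ : i ∈ Finset.univ) => hrank i
  rw [srk]
  simp at hc
  omega

theorem minDist_eq_of_le {C : Submodule F (Ambient F m n)} {w : ℕ}
    (h : ∀ X ∈ C, X ≠ 0 → w ≤ srk X) (h' : ∃ X ∈ C, X ≠ 0 ∧ srk X ≤ w) : minDist C = w := by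
  obtain ⟨X, hX, hX0, hXw⟩ := h'
  refine IsLeast.csInf_eq ⟨⟨X, hX, hX0, le_antisymm hXw (h X hX hX0)⟩, ?_⟩
  rintro _ ⟨Y, hY, hY0, rfl⟩
  exact h Y hY hY0

/-- The parameters of linearized Reed-Solomon codes. -/
theorem linearizedReedSolomon [Module.Finite F L] (σ : L ≃ₐ[F] L)
    (hσ : ∀ x, σ x = x → x ∈ Set.range (algebraMap F L)) (a : Fin t → L)
    (ha0 : ∀ i, a i ≠ 0)
    (ha : ∀ i j x y, x ≠ 0 → y ≠ 0 → a i * σ x * y = a j * σ y * x → i = j)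
    (β : ∀ i, (Fin (n i) → F) →ₗ[F] L) (e : ∀ i, L →ₗ[F] (Fin (m i) → F))
    (hβ : ∀ i, Function.Injective (β i)) (he : ∀ i, Function.Injective (e i))
    (K : ℕ) (hK : K < ∑ i, n i) :
    minDist (((degreeLT L (K + 1)).restrictScalars F).map (encode σ a β e)) + K = ∑ i, n i ∧
    finrank F (((degreeLT L (K + 1)).restrictScalars F).map (encode σ a β e)) =
      finrank F L * (K + 1) := by
  have hwt : ∀ f ∈ degreeLT L (K + 1), f ≠ 0 → ∑ i, n i ≤ srk (encode σ a β e f) + K := by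
    intro f hf hf0
    have h := le_srk_encode_add_natDegree σ hσ a ha0 ha β e hβ he f hf0
    have : f.natDegree < K + 1 := (natDegree_lt_iff_degree_lt hf0).mpr (mem_degreeLT.mp hf)
    omega
  have hne : ∀ f ∈ degreeLT L (K + 1), f ≠ 0 → encode σ a β e f ≠ 0 := by
    intro f hf hf0 h0
    have := hwt f hf hf0
    rw [h0] at this
    simp [srk] at this
    omega
  constructor
  · rw [minDist_eq_of_le (w := ∑ i, n i - K), Nat.sub_add_cancel hK.le]
    · rintro _ ⟨f, hf, rfl⟩ h0
      have := hwt f hf (by rintro rfl; simp at h0)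
      omega
    · obtain ⟨f, hf, hf0, hle⟩ := exists_srk_encode_add_le σ a β e K hK
      exact ⟨_, ⟨f, hf, rfl⟩, hne f hf hf0, by omega⟩
  · rw [← finrank_degreeLT_restrictScalars]
    have hinj : Function.Injective
        ((encode σ a β e).domRestrict ((degreeLT L (K + 1)).restrictScalars F)) := by
      rw [← LinearMap.ker_eq_bot, LinearMap.ker_eq_bot']
      rintro ⟨f, hf⟩ h
      by_contra h0
      exact hne f hf (fun h => h0 (Subtype.ext h)) h
    rw [← LinearMap.range_domRestrict, LinearMap.finrank_range_of_inj hinj]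

end Code

end SumRank

/-! ### Field data, the MSRD dimension formula and the conclusion -/

namespace SumRank

open Polynomial Module

/-- A finite field has an extension of every positive degree, with an automorphism whose fixed
field is the base field. -/
theorem exists_extension_fixed (F : Type*) [Field F] [Finite F] (M : ℕ) (hM : 0 < M) :
    ∃ (L : Type) (_ : Field L) (_ : Algebra F L) (_ : Finite L) (_ : Module.Finite F L)
      (σ : L ≃ₐ[F] L), finrank F L = M ∧ ∀ x, σ x = x → x ∈ Set.range (algebraMap F L) := by
  obtain ⟨p, hp⟩ := CharP.exists F
  have : Fact p.Prime := ⟨CharP.char_is_prime F p⟩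
  have : NeZero M := ⟨hM.ne'⟩
  refine ⟨FiniteField.Extension F p M, inferInstance, inferInstance, inferInstance, inferInstance,
    FiniteField.Extension.frob F p M, FiniteField.finrank_extension F p M, fun x hx => ?_⟩
  -- Powers of Frobenius exhaust the Galois group, so being fixed by Frobenius suffices.
  rw [IsGalois.mem_range_algebraMap_iff_fixed]
  intro g
  obtain ⟨k, -, rfl⟩ := FiniteField.Extension.exists_frob_pow_eq F p M g
  clear * - hx
  induction k with
  | zero => simp
  | succ k ih => rw [pow_succ, AlgEquiv.mul_apply, hx, ih]

/-- Over a field with more than `t` elements there are `t` nonzero elements of the extension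
that are pairwise non-conjugate. -/
theorem exists_nonconjugate {F L : Type*} [Field F] [Fintype F] [Field L] [Algebra F L] [Finite L]
    (σ : L ≃ₐ[F] L) {t : ℕ} (ht : t < Fintype.card F) :
    ∃ a : Fin t → L, (∀ i, a i ≠ 0) ∧
      ∀ i j x y, x ≠ 0 → y ≠ 0 → a i * σ x * y = a j * σ y * x → i = j := by
  classical
  obtain ⟨φ⟩ : Nonempty (Fin t ↪ Fˣ) := Function.Embedding.nonempty_of_card_le (by
    rw [Fintype.card_fin, Fintype.card_units]
    omega)
  choose a ha using fun i => FiniteField.norm_surjective F L (φ i : F)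
  refine ⟨a, fun i h => ?_, fun i j x y hx hy h => ?_⟩
  · have := ha i
    rw [h, Algebra.norm_zero] at this
    exact (φ i).ne_zero this.symm
  -- The norm is `σ`-invariant, so conjugate elements have equal norms.
  · have hN := congrArg (Algebra.norm F) h
    simp only [map_mul, Algebra.norm_eq_of_algEquiv, ha] at hN
    have hx' : Algebra.norm F x ≠ 0 := Algebra.norm_ne_zero_iff.mpr hx
    have hy' : Algebra.norm F y ≠ 0 := Algebra.norm_ne_zero_iff.mpr hy
    apply φ.injective
    apply Units.ext
    apply mul_right_cancel₀ (mul_ne_zero hx' hy')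
    linear_combination hN

/-- Every `0 < w ≤ ∑ i, n i` lies in exactly one of the consecutive intervals of lengths `n i`;
this is the existence part. -/
theorem exists_eq_sum_Iio_add {t : ℕ} (n : Fin t → ℕ) {w : ℕ} (hw0 : 0 < w)
    (hw : w ≤ ∑ i, n i) : ∃ k δ, δ < n k ∧ w = ∑ i ∈ Finset.Iio k, n i + δ + 1 := by
  have hne : {k : Fin t | ∑ i ∈ Finset.Iio k, n i < w}.Nonempty := by
    rcases t with - | t
    · simp at hw
      omega
    · refine ⟨0, ?_⟩
      rw [Set.mem_ofPred_eq, Finset.sum_eq_zero fun i hi => ?_]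
      · exact hw0
      · exact absurd (Finset.mem_Iio.mp hi) (Fin.not_lt_zero i)
  -- The last block whose predecessors total less than `w` is the one containing `w`.
  obtain ⟨k, hk⟩ := (Set.toFinite _).exists_maximal hne
  refine ⟨k, w - 1 - ∑ i ∈ Finset.Iio k, n i, ?_, ?_⟩
  · have hlt : ∑ i ∈ Finset.Iio k, n i < w := hk.prop
    have hle : w ≤ ∑ i ∈ Finset.Iic k, n i := by
      by_contra! h
      by_cases hlast : k.val + 1 < t
      · have hIio : Finset.Iio (⟨k.val + 1, hlast⟩ : Fin t) = Finset.Iic k := by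
          ext x
          rw [Finset.mem_Iio, Finset.mem_Iic, Fin.lt_def, Fin.le_def, Nat.lt_succ_iff]
        have := hk.le_of_ge (y := ⟨k.val + 1, hlast⟩) (by simpa [hIio] using h)
          (by simp [Fin.le_def])
        simp [Fin.le_def] at this
      · have huniv : Finset.Iic k = Finset.univ := by
          ext x
          rw [Finset.mem_Iic, Fin.le_def]
          exact iff_of_true (by omega) (Finset.mem_univ x)
        rw [huniv] at h
        omega
    rw [← Finset.Iio_insert, Finset.sum_insert (by simp)] at hle
    omega
  · have hlt : ∑ i ∈ Finset.Iio k, n i < w := hk.prop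
    omega

/-- A code of the right dimension whose minimum distance exceeds `∑ i < j, n i` is MSRD, when
`m` is constant on the blocks from `j` on. -/
theorem isMSRD_of_finrank {F : Type*} [Field F] {t : ℕ} {m n : Fin t → ℕ}
    (C : Submodule F (Ambient F m n)) (M : ℕ) (j : Fin t) (hmM : ∀ i, j ≤ i → m i = M)
    (hj : ∑ i ∈ Finset.Iio j, n i < minDist C) {K : ℕ} (hK : minDist C + K = ∑ i, n i)
    (hC : finrank F C = M * (K + 1)) : IsMSRD C := by
  obtain ⟨k, δ, hδ, hk⟩ := exists_eq_sum_Iio_add n (Nat.zero_lt_of_lt hj) (by omega)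
  refine ⟨k, δ, hδ, hk, ?_⟩
  -- If `k < j`, the blocks up to `k` would already reach the distance, against `hj`.
  have hjk : j ≤ k := by
    by_contra! h
    have : ∑ i ∈ Finset.Iic k, n i ≤ ∑ i ∈ Finset.Iio j, n i :=
      Finset.sum_le_sum_of_subset fun x hx => by
        simp only [Finset.mem_Iic, Finset.mem_Iio] at hx ⊢
        exact hx.trans_lt h
    rw [← Finset.Iio_insert, Finset.sum_insert (by simp)] at this
    omega
  have hsplit : ∑ i ∈ Finset.Iio k, n i + ∑ i ∈ Finset.Ici k, n i = ∑ i, n i := by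
    rw [← Finset.sum_union]
    · congr 1
      ext x
      simp [lt_or_ge]
    · rw [Finset.disjoint_left]
      intro x hx hx'
      simp only [Finset.mem_Iio, Finset.mem_Ici] at hx hx'
      exact absurd hx (not_lt.mpr hx')
  have hsum : ∑ i ∈ Finset.Ici k, m i * n i = M * ∑ i ∈ Finset.Ici k, n i := by
    rw [Finset.mul_sum]
    exact Finset.sum_congr rfl fun i hi => by rw [hmM i (hjk.trans (Finset.mem_Ici.mp hi))]
  rw [hC, hsum, hmM k hjk, mul_comm δ, ← mul_add]
  congr 1
  omega

end SumRank

theorem proposition4p11 {F : Type*} [Field F] [Fintype F] (t : ℕ) (ht : 0 < t)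
    (m n : Fin t → ℕ) (hn : ∀ i, 0 < n i) (hm : Antitone m)
    (hnm : ∀ i, n i ≤ m ⟨t - 1, Nat.sub_one_lt_of_lt ht⟩)
    (hq : t < Fintype.card F)
    (j : Fin t) (hj : IsLeast {i : Fin t | m i = m ⟨t - 1, Nat.sub_one_lt_of_lt ht⟩} j)
    (d : ℕ) (hd : d = (∑ i ∈ Finset.Iio j, n i) + 1) :
    ∃ C : ℕ → Submodule F (SumRank.Ambient F m n),
      AntitoneOn C (Set.Icc d (∑ i, n i)) ∧
      ∀ i ∈ Set.Icc d (∑ i, n i),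
        SumRank.IsMSRD (C i) ∧ SumRank.minDist (C i) = i := by
  have hlast : ∀ i, m ⟨t - 1, Nat.sub_one_lt_of_lt ht⟩ ≤ m i := fun i =>
    hm (Fin.le_def.mpr (Nat.le_sub_one_of_lt i.isLt))
  obtain ⟨L, _, _, _, _, σ, hfin, hσ⟩ := SumRank.exists_extension_fixed F
    (m ⟨t - 1, Nat.sub_one_lt_of_lt ht⟩) ((hn ⟨0, ht⟩).trans_le (hnm _))
  obtain ⟨a, ha0, ha⟩ := SumRank.exists_nonconjugate σ hq
  have hβ : ∀ i, ∃ β : (Fin (n i) → F) →ₗ[F] L, Function.Injective β := fun i =>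
    finrank_le_iff_exists_linearMap.mp (by rw [Module.finrank_fin_fun, hfin]; exact hnm i)
  have he : ∀ i, ∃ e : L →ₗ[F] (Fin (m i) → F), Function.Injective e := fun i =>
    finrank_le_iff_exists_linearMap.mp (by rw [Module.finrank_fin_fun, hfin]; exact hlast i)
  choose β hβ using hβ
  choose e he using he
  -- Degree at most `∑ n i - i` gives distance exactly `i`.
  refine ⟨fun i => ((Polynomial.degreeLT L (∑ i, n i - i + 1)).restrictScalars F).map
    (SumRank.encode σ a β e), ?_, ?_⟩
  · intro i _ k _ hik
    exact Submodule.map_mono (Polynomial.degreeLT_mono (by omega))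
  · rintro i ⟨hdi, hin⟩
    dsimp only
    obtain ⟨hdist, hdim⟩ := SumRank.linearizedReedSolomon σ hσ a ha0 ha β e hβ he
      (∑ i, n i - i) (by omega)
    refine ⟨SumRank.isMSRD_of_finrank _ _ j (fun k hk => ?_) (by omega) hdist
      (hfin ▸ hdim), by omega⟩
    exact le_antisymm ((hm hk).trans_eq hj.1) (hlast k)
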